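/- **Proposition 5.1.** Let $\Lambda,\Gamma$ be infinite sets with $\operatorname{card}\Lambda\ge\operatorname{card}\Gamma$. For $\mathbb K\in\{\mathbb R,\mathbb C\}$ and an infinite set $I$, let $\mathbb K^I$ be the space of all functions $I\to\mathbb K$ with pointwise operations, endowed with the uniform topology, i.e. the topology of the metric $$d(f,g)=\sup_{i\in I}\min\{1,|f(i)-g(i)|\}.$$ Let $\mathcal{CS}(\mathbb K^\Lambda,\mathbb K^\Gamma)$ be the set of all continuous surjective maps $\mathbb K^\Lambda\to\mathbb K^\Gamma$, a subset of the algebra over $\mathbb K$ of all maps $\mathbb K^\Lambda\to\mathbb K^\Gamma$ with pointwise operations. Then: (a) $\mathcal{CS}(\mathbb R^\Lambda,\mathbb R^\Gamma)$ is $2^{\operatorname{card}\Gamma}$-lineable, that is, $\mathcal{CS}(\mathbb R^\Lambda,\mathbb R^\Gamma)\cup\{0\}$ contains a real vector space of dimension $2^{\operatorname{card}\Gamma}$; (b) $\mathcal{CS}(\mathbb C^\Lambda,\mathbb C^\Gamma)$ is $2^{\operatorname{card}\Gamma}$-algebrable, that is, $\mathcal{CS}(\mathbb C^\Lambda,\mathbb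 C^\Gamma)\cup\{0\}$ contains a (not necessarily unital) complex algebra for which $2^{\operatorname{card}\Gamma}$ is the smallest cardinality of a system of generators. -/

import Mathlib

open Cardinal

universe u v

noncomputable section

/-- The metric `d(f, g) = sup_i min {1, |f i - g i|}` on the space `E^I` of all functions
`I → E`; its topology is the uniform topology. The supremum is that of a family bounded by `1`. -/
@[reducible]
def uniformMetric (I E : Type*) [NormedAddCommGroup E] : MetricSpace (I → E) where
  dist f g := ⨆ i, min 1 ‖f i - g i‖
  dist_self f := by simp
  dist_comm f g := by simp only [norm_sub_rev]
  dist_triangle f g h := by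
    have hb : ∀ a b : I → E, BddAbove (Set.range fun i => min 1 ‖a i - b i‖) := by
      rintro a b
      refine ⟨1, ?_⟩
      rintro _ ⟨i, rfl⟩
      exact min_le_left _ _
    have h0 : ∀ a b : I → E, 0 ≤ ⨆ i, min 1 ‖a i - b i‖ := fun a b =>
      Real.iSup_nonneg fun i => le_min zero_le_one (norm_nonneg _)
    refine Real.iSup_le (fun i => ?_) (add_nonneg (h0 f g) (h0 g h))
    refine le_trans ?_ (add_le_add (le_ciSup (hb f g) i) (le_ciSup (hb g h) i))
    have h1 : ‖f i - h i‖ ≤ ‖f i - g i‖ + ‖g i - h i‖ := norm_sub_le_norm_sub_add_norm_sub _ _ _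
    have h2 := norm_nonneg (f i - g i)
    have h3 := norm_nonneg (g i - h i)
    rcases le_total 1 ‖f i - g i‖ with h4 | h4 <;> rcases le_total 1 ‖g i - h i‖ with h5 | h5 <;>
      rcases le_total 1 ‖f i - h i‖ with h6 | h6 <;> simp [h4, h5, h6] <;> linarith
  eq_of_dist_eq_zero := by
    rintro f g hfg
    change (⨆ i, min 1 ‖f i - g i‖) = 0 at hfg
    funext i
    have hb : BddAbove (Set.range fun i => min 1 ‖f i - g i‖) := by
      refine ⟨1, ?_⟩
      rintro _ ⟨i, rfl⟩
      exact min_le_left _ _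
    have h1 : min 1 ‖f i - g i‖ ≤ 0 := hfg ▸ le_ciSup hb i
    rcases min_le_iff.1 h1 with h2 | h2
    · exact absurd h2 (by norm_num)
    · exact sub_eq_zero.1 (norm_le_zero_iff.1 h2)

/-- The uniform topology on `E^I`. -/
@[reducible]
def uniformTopology (I E : Type*) [NormedAddCommGroup E] : TopologicalSpace (I → E) :=
  (uniformMetric I E).toUniformSpace.toTopologicalSpace

/-- The set `CS(E^Λ, E^Γ)` of all continuous surjective maps `E^Λ → E^Γ`, where both spaces carry
the uniform topology (and not Lean's default topology on function types, the product topology). -/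
def uniformCS (Λ Γ E : Type*) [NormedAddCommGroup E] : Set ((Λ → E) → (Γ → E)) :=
  {F | @Continuous _ _ (uniformTopology Λ E) (uniformTopology Γ E) F ∧ Function.Surjective F}

/-- A subset `M` of a vector space `V` is `μ`-lineable if `M ∪ {0}` contains a linear subspace of
dimension `μ`. -/
def IsLineable (𝕜 : Type*) {V : Type*} [Field 𝕜] [AddCommGroup V] [Module 𝕜 V]
    (M : Set V) (μ : Cardinal) : Prop :=
  ∃ W : Submodule 𝕜 V, (W : Set V) ⊆ M ∪ {0} ∧ Module.rank 𝕜 W = μ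

/-- A (not necessarily unital) subalgebra `C` is `κ`-generated if `κ` is the smallest cardinality
of a system of generators of `C`. -/
def IsCardGenerated {𝕜 A : Type*} [Field 𝕜] [CommRing A] [Algebra 𝕜 A]
    (C : NonUnitalSubalgebra 𝕜 A) (κ : Cardinal) : Prop :=
  (∃ S : Set A, NonUnitalAlgebra.adjoin 𝕜 S = C ∧ #S = κ) ∧
    ∀ S : Set A, NonUnitalAlgebra.adjoin 𝕜 S = C → κ ≤ #S

/-- A subset `B` of an algebra `A` is `κ`-algebrable if `B ∪ {0}` contains a `κ`-generated
subalgebra of `A` (subalgebras need not contain `1`). -/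
def IsAlgebrable (𝕜 : Type*) {A : Type*} [Field 𝕜] [CommRing A] [Algebra 𝕜 A]
    (B : Set A) (κ : Cardinal) : Prop :=
  ∃ C : NonUnitalSubalgebra 𝕜 A, (C : Set A) ⊆ B ∪ {0} ∧ IsCardGenerated C κ

end

/-! Embed `Γ × ℕ` in `Λ` and send a function to the set of `γ` over whose fibre it is unbounded. A
perturbation of uniform size at most 1 does not change this set, and every subset of `Γ` occurs. So
any map that factors through `Set Γ` is continuous, and only surjectivity is at stake.

There are at most `2 ^ #Γ` pairs (operation, target), where an operation is a nonzero linear form or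
a nonzero polynomial without constant term, so subsets of `Γ` can encode all pairs. At the code of
`(a, y)` the family is given values that `a` carries to `y` (`exists_family_surjective`). Hence each
such operation turns the family, indexed by `Set Γ`, into a surjection. Surjections are nonzero, so
the family is linearly independent. -/

/-- The set of those `γ` along whose fibre `n ↦ x (ι (γ, n))` the function `x` is unbounded. -/
def unboundedFibres {Λ Γ E : Type*} [NormedAddCommGroup E] (ι : Γ × ℕ → Λ) (x : Λ → E) : Set Γ :=
  {γ | ¬ ∃ C : ℝ, ∀ n, ‖x (ι (γ, n))‖ ≤ C}

theorem norm_sub_le_one_of_uniformDist_lt_one {I E : Type*} [NormedAddCommGroup E] {x y : I → E}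
    (h : (⨆ i, min 1 ‖x i - y i‖) < 1) (i : I) : ‖x i - y i‖ ≤ 1 := by
  have hb : BddAbove (Set.range fun i => min 1 ‖x i - y i‖) := by
    refine ⟨1, ?_⟩
    rintro _ ⟨i, rfl⟩
    exact min_le_left _ _
  have h1 := (le_ciSup hb i).trans_lt h
  rcases min_lt_iff.1 h1 with h2 | h2
  · exact absurd h2 (lt_irrefl _)
  · exact h2.le

theorem unboundedFibres_subset {Λ Γ E : Type*} [NormedAddCommGroup E] (ι : Γ × ℕ → Λ)
    {x y : Λ → E} (h : ∀ i, ‖x i - y i‖ ≤ 1) : unboundedFibres ι x ⊆ unboundedFibres ι y := by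
  rintro γ hγ ⟨C, hC⟩
  refine hγ ⟨1 + C, fun n => ?_⟩
  calc ‖x (ι (γ, n))‖ = ‖(x (ι (γ, n)) - y (ι (γ, n))) + y (ι (γ, n))‖ := by rw [sub_add_cancel]
    _ ≤ ‖x (ι (γ, n)) - y (ι (γ, n))‖ + ‖y (ι (γ, n))‖ := norm_add_le _ _
    _ ≤ 1 + C := add_le_add (h _) (hC n)

theorem unboundedFibres_eq {Λ Γ E : Type*} [NormedAddCommGroup E] (ι : Γ × ℕ → Λ)
    {x y : Λ → E} (h : ∀ i, ‖x i - y i‖ ≤ 1) : unboundedFibres ι x = unboundedFibres ι y :=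
  (unboundedFibres_subset ι h).antisymm
    (unboundedFibres_subset ι fun i => by rw [norm_sub_rev]; exact h i)

theorem unboundedFibres_surjective {Λ Γ 𝕜 : Type*} [RCLike 𝕜] {ι : Γ × ℕ → Λ}
    (hι : Function.Injective ι) :
    Function.Surjective (unboundedFibres ι : (Λ → 𝕜) → Set Γ) := by
  classical
  intro A
  let y : Γ × ℕ → 𝕜 := fun q => if q.1 ∈ A then (q.2 : 𝕜) else 0
  have hy : ∀ q, Function.extend ι y 0 (ι q) = y q := hι.extend_apply y 0
  refine ⟨Function.extend ι y 0, ?_⟩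
  ext γ
  simp only [unboundedFibres, Set.mem_ofPred_eq, hy, y]
  by_cases hγ : γ ∈ A
  · simp only [hγ, if_true, RCLike.norm_natCast, iff_true]
    rintro ⟨C, hC⟩
    obtain ⟨n, hn⟩ := exists_nat_gt C
    exact absurd (hC n) hn.not_ge
  · simp only [hγ, if_false, norm_zero, iff_false, not_not]
    exact ⟨0, fun _ => le_rfl⟩

/-- A map that factors through `unboundedFibres` is locally constant, hence continuous. -/
theorem continuous_uniform_of_factors {Λ Γ Γ' E : Type*} [NormedAddCommGroup E]
    (ι : Γ × ℕ → Λ) (F : (Λ → E) → (Γ' → E))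
    (hF : ∀ x y, unboundedFibres ι x = unboundedFibres ι y → F x = F y) :
    @Continuous _ _ (uniformTopology Λ E) (uniformTopology Γ' E) F := by
  let := uniformMetric Λ E
  let := uniformMetric Γ' E
  -- Radius 1 serves every `ε`: the truncated distance being below 1 means that the truncation is
  -- inactive.
  refine Metric.continuous_iff.2 fun x ε hε => ⟨1, one_pos, fun y hy => ?_⟩
  rw [hF y x (unboundedFibres_eq ι (norm_sub_le_one_of_uniformDist_lt_one hy)), dist_self]
  exact hε

theorem mk_fun_le_two_power {Γ : Type v} [Infinite Γ] {K : Type} (hK : #K ≤ 𝔠) :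
    #(Γ → K) ≤ 2 ^ #Γ := by
  have h : (lift.{v} #K) ≤ 𝔠 := by simpa using lift_le.{v}.2 hK
  calc #(Γ → K) = (lift.{v} #K) ^ #Γ := by simp
    _ ≤ 𝔠 ^ #Γ := power_le_power_right h
    _ = 2 ^ #Γ := by
      rw [← two_power_aleph0, ← power_mul, aleph0_mul_eq (aleph0_le_mk Γ)]

theorem continuum_le_two_power {Γ : Type v} [Infinite Γ] : 𝔠 ≤ (2 : Cardinal.{v}) ^ #Γ := by
  rw [← two_power_aleph0]
  exact power_le_power_left two_ne_zero (aleph0_le_mk Γ)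

/-- A family of locally constant maps `𝕜^Λ → 𝕜^Γ` that is carried to a surjective map by each of
at most `2 ^ #Γ` prescribed surjective coordinatewise operations. -/
theorem exists_family_surjective {Λ : Type u} {Γ : Type v} [Infinite Γ] {𝕜 : Type} [RCLike 𝕜]
    (h𝕜 : #𝕜 ≤ 𝔠) {ι : Γ × ℕ → Λ} (hι : Function.Injective ι) {J P : Type v} (hP : #P ≤ 2 ^ #Γ)
    (p : P → (J → 𝕜) → 𝕜) (hp : ∀ a, Function.Surjective (p a)) :
    ∃ f : J → (Λ → 𝕜) → (Γ → 𝕜),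
      (∀ j x y, unboundedFibres ι x = unboundedFibres ι y → f j x = f j y) ∧
      ∀ a (y : Γ → 𝕜), ∃ x, ∀ γ, p a (fun j => f j x γ) = y γ := by
  -- `Function.invFun` below needs a nonempty codomain.
  rcases isEmpty_or_nonempty P with hP0 | hP0
  · exact ⟨fun _ _ => 0, fun _ _ _ _ => rfl, fun a => isEmptyElim a⟩
  have hle : #(P × (Γ → 𝕜)) ≤ #(Set Γ) := by
    rw [mk_prod, lift_id, lift_id, mk_set]
    have h2 : ℵ₀ ≤ (2 : Cardinal.{v}) ^ #Γ := aleph0_le_continuum.trans continuum_le_two_power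
    exact mul_le_of_le h2 hP (mk_fun_le_two_power h𝕜)
  obtain ⟨e⟩ := hle
  choose z hz using hp
  let s : Set Γ → P × (Γ → 𝕜) := Function.invFun e
  have hs : Function.Surjective s := Function.invFun_surjective e.injective
  -- The set attached to `x` decodes to a pair `(a, y)`; the values at `γ` form a chosen preimage of
  -- `y γ` under `p a`.
  refine ⟨fun j x γ => z (s (unboundedFibres ι x)).1 ((s (unboundedFibres ι x)).2 γ) j,
    fun j x y h => by simp only [h], fun a y => ?_⟩
  obtain ⟨A, hA⟩ := hs (a, y)
  obtain ⟨x, hx⟩ := unboundedFibres_surjective (𝕜 := 𝕜) hι A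
  exact ⟨x, fun γ => by simp only [hx, hA]; exact hz a (y γ)⟩

theorem exists_injective_prod_nat {Λ : Type u} {Γ : Type v} [Infinite Γ]
    (hcard : Cardinal.lift.{u} #Γ ≤ Cardinal.lift.{v} #Λ) :
    ∃ ι : Γ × ℕ → Λ, Function.Injective ι := by
  have h : #(Γ × ℕ) = #Γ := by simp [mul_aleph0_eq (aleph0_le_mk Γ)]
  obtain ⟨e⟩ := Cardinal.lift_mk_le'.1 (h.symm ▸ hcard : lift.{u} #(Γ × ℕ) ≤ lift.{v} #Λ)
  exact ⟨e, e.injective⟩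

theorem linearCombination_surjective {J 𝕜 : Type*} [Field 𝕜] {c : J →₀ 𝕜} (hc : c ≠ 0) :
    Function.Surjective fun z : J → 𝕜 => Finsupp.linearCombination 𝕜 z c := by
  classical
  intro y
  obtain ⟨j, hj⟩ := Finsupp.ne_iff.1 hc
  have hj' : c j ≠ 0 := hj
  refine ⟨Pi.single j (y / c j), ?_⟩
  simp only [Finsupp.linearCombination_apply, Finsupp.sum, smul_eq_mul]
  rw [Finset.sum_eq_single j]
  · rw [Pi.single_eq_same, mul_div_cancel₀ _ hj']
  · intro b _ hb
    rw [Pi.single_eq_of_ne hb, mul_zero]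
  · intro h
    rw [Finsupp.notMem_support_iff.1 h, zero_mul]

/-- Over an algebraically closed field, a nonzero polynomial without constant term is a
surjective function. -/
theorem MvPolynomial.eval_surjective_of_constantCoeff_eq_zero {J k : Type*} [Field k]
    [IsAlgClosed k] {P : MvPolynomial J k} (hP : P ≠ 0) (h0 : constantCoeff P = 0) :
    Function.Surjective fun z : J → k => eval z P := by
  have : Infinite k := IsAlgClosed.instInfinite
  obtain ⟨w, hw⟩ : ∃ w, eval w P ≠ 0 := by
    by_contra! h
    exact hP (MvPolynomial.funext fun w => by rw [h w, map_zero])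
  -- Restriction of `P` to the line through 0 and `w`: it vanishes at 0 but not at 1, hence is
  -- nonconstant.
  let Q : Polynomial k := aeval (fun j => Polynomial.X * Polynomial.C (w j)) P
  have hQ : ∀ t, Q.eval t = eval (fun j => t * w j) P := fun t => by
    have := MvPolynomial.map_aeval (fun j => Polynomial.X * Polynomial.C (w j))
      (Polynomial.evalRingHom t) P
    simp only [Polynomial.coe_evalRingHom] at this
    rw [this]
    simp only [Polynomial.eval_mul, Polynomial.eval_X, Polynomial.eval_C, eval]
    congr 2
    ext a
    simp
  have hdeg : Q.natDegree ≠ 0 := by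
    intro h
    obtain ⟨a, ha⟩ := Polynomial.natDegree_eq_zero.1 h
    have e0 := hQ 0
    have e1 := hQ 1
    rw [← ha, Polynomial.eval_C] at e0 e1
    simp only [zero_mul, one_mul] at e0 e1
    have e2 : eval (fun _ => (0 : k)) P = 0 := by
      exact (congrFun (congrArg DFunLike.coe (MvPolynomial.eval_zero)) P).trans h0
    exact hw (by rw [← e1, e0, e2])
  intro y
  obtain ⟨t, ht⟩ := IsAlgClosed.eval_surjective hdeg y
  exact ⟨fun j => t * w j, (hQ t).symm.trans ht⟩

theorem NonUnitalAlgebra.exists_aeval_of_mem_adjoin_range {J R A : Type*} [CommRing R] [CommRing A]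
    [Algebra R A] {f : J → A} {a : A} (ha : a ∈ NonUnitalAlgebra.adjoin R (Set.range f)) :
    ∃ P : MvPolynomial J R, MvPolynomial.constantCoeff P = 0 ∧ MvPolynomial.aeval f P = a := by
  induction ha using NonUnitalAlgebra.adjoin_induction with
  | mem x hx =>
    obtain ⟨j, rfl⟩ := hx
    exact ⟨MvPolynomial.X j, by simp, by simp⟩
  | add x y _ _ hx hy =>
    obtain ⟨P, hP, rfl⟩ := hx
    obtain ⟨Q, hQ, rfl⟩ := hy
    exact ⟨P + Q, by simp [hP, hQ], by simp⟩
  | zero => exact ⟨0, by simp, by simp⟩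
  | mul x y _ _ hx hy =>
    obtain ⟨P, hP, rfl⟩ := hx
    obtain ⟨Q, hQ, rfl⟩ := hy
    exact ⟨P * Q, by simp [hP], by simp⟩
  | smul r x _ hx =>
    obtain ⟨P, hP, rfl⟩ := hx
    exact ⟨r • P, by simp [hP], by simp⟩

/-- Every element of the closure is the product of a finite word in `S`. -/
theorem Subsemigroup.mk_closure_le {A : Type*} [Monoid A] (S : Set A) :
    #(Subsemigroup.closure S) ≤ max ℵ₀ #S := by
  have hsub : (Subsemigroup.closure S : Set A) ⊆
      Set.range (FreeMonoid.lift ((↑) : S → A)) := by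
    rw [← MonoidHom.coe_mrange, ← Submonoid.closure_eq_mrange]
    exact (Subsemigroup.closure_le (S := (Submonoid.closure S).toSubsemigroup)).2
      Submonoid.subset_closure
  calc #(Subsemigroup.closure S) ≤ #(Set.range (FreeMonoid.lift ((↑) : S → A))) :=
        mk_le_mk_of_subset hsub
    _ ≤ #(FreeMonoid S) := mk_range_le
    _ ≤ max ℵ₀ #S := mk_list_le_max S

theorem NonUnitalAlgebra.rank_adjoin_le {k A : Type*} [Field k] [CommRing A] [Algebra k A]
    (S : Set A) :
    Module.rank k (NonUnitalAlgebra.adjoin k S).toSubmodule ≤ max ℵ₀ #S := by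
  rw [NonUnitalAlgebra.adjoin_eq_span]
  exact (rank_span_le _).trans (Subsemigroup.mk_closure_le S)

/-- A generating set `S` bounds the dimension by `max ℵ₀ #S`, while the independent family bounds it
from below; uncountability discards the `ℵ₀`. -/
theorem isCardGenerated_adjoin_range {k A : Type*} {J : Type*} [Field k] [CommRing A] [Algebra k A]
    {f : J → A} (hf : LinearIndependent k f) (hJ : ℵ₀ < #(Set.range f)) :
    IsCardGenerated (NonUnitalAlgebra.adjoin k (Set.range f)) #(Set.range f) := by
  refine ⟨⟨_, rfl, rfl⟩, fun S hS => ?_⟩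
  have h1 : #(Set.range f) ≤ max ℵ₀ #S := by
    rw [← rank_span hf]
    refine le_trans (Submodule.rank_mono ?_) (NonUnitalAlgebra.rank_adjoin_le (k := k) S)
    rw [hS]
    exact Submodule.span_le.2 (NonUnitalAlgebra.subset_adjoin k)
  exact (le_max_iff.1 h1).resolve_left hJ.not_ge

theorem not_surjective_zero {X Γ E : Type*} [Nonempty Γ] [Zero E] [Nontrivial E] :
    ¬ Function.Surjective (0 : X → Γ → E) := by
  intro h
  obtain ⟨e, he⟩ := exists_ne (0 : E)
  obtain ⟨x, hx⟩ := h fun _ => e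
  exact he (congrFun hx (Classical.arbitrary Γ)).symm

theorem mk_range_set_eq {Γ : Type v} {A : Type (max u v)} {f : Set Γ → A}
    (hf : Function.Injective f) : #(Set.range f) = Cardinal.lift.{u} (2 ^ #Γ) := by
  have h := mk_range_eq_of_injective hf
  rw [lift_id'.{v, max u v}, lift_umax.{v, u}, mk_set] at h
  exact h

theorem isLineable_uniformCS {Λ : Type u} {Γ : Type v} [Infinite Γ]
    (hcard : Cardinal.lift.{u} #Γ ≤ Cardinal.lift.{v} #Λ) :
    IsLineable ℝ (uniformCS Λ Γ ℝ) (Cardinal.lift.{u} (2 ^ #Γ)) := by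
  obtain ⟨ι, hι⟩ := exists_injective_prod_nat hcard
  have hP : #{c : Set Γ →₀ ℝ // c ≠ 0} ≤ 2 ^ #Γ := by
    refine (mk_subtype_le _).trans ?_
    rw [mk_finsupp_lift_of_infinite, mk_set, mk_real, lift_continuum, lift_id']
    exact max_le le_rfl continuum_le_two_power
  obtain ⟨f, hfc, hfs⟩ := exists_family_surjective mk_real.le hι hP
    (fun c z => Finsupp.linearCombination ℝ z c.1) fun c => linearCombination_surjective c.2
  have happ : ∀ c x γ, Finsupp.linearCombination ℝ f c x γ =
      Finsupp.linearCombination ℝ (fun j => f j x γ) c := fun c x γ => by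
    simp [Finsupp.linearCombination_apply, Finsupp.sum]
  have hsurj : ∀ c, c ≠ 0 → Function.Surjective (Finsupp.linearCombination ℝ f c) := by
    intro c hc y
    obtain ⟨x, hx⟩ := hfs ⟨c, hc⟩ y
    exact ⟨x, funext fun γ => by rw [happ]; exact hx γ⟩
  have hli : LinearIndependent ℝ f := by
    refine linearIndependent_iff.2 fun c hc => ?_
    by_contra h
    exact not_surjective_zero (hc ▸ hsurj c h)
  refine ⟨Submodule.span ℝ (Set.range f), fun F hF => ?_, ?_⟩
  · obtain ⟨c, rfl⟩ := Finsupp.mem_span_range_iff_exists_finsupp.1 hF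
    change Finsupp.linearCombination ℝ f c ∈ _
    by_cases hc : c = 0
    · exact Or.inr (by simp [hc])
    · refine Or.inl ⟨continuous_uniform_of_factors ι _ fun x y hxy => ?_, hsurj c hc⟩
      funext γ
      simp only [happ, fun j => hfc j x y hxy]
  · rw [rank_span hli, mk_range_set_eq hli.injective]

theorem isAlgebrable_uniformCS {Λ : Type u} {Γ : Type v} [Infinite Γ]
    (hcard : Cardinal.lift.{u} #Γ ≤ Cardinal.lift.{v} #Λ) :
    IsAlgebrable ℂ (uniformCS Λ Γ ℂ) (Cardinal.lift.{u} (2 ^ #Γ)) := by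
  obtain ⟨ι, hι⟩ := exists_injective_prod_nat hcard
  have hP : #{P : MvPolynomial (Set Γ) ℂ // P ≠ 0 ∧ MvPolynomial.constantCoeff P = 0} ≤
      2 ^ #Γ := by
    refine (mk_subtype_le _).trans (MvPolynomial.cardinalMk_le_max_lift.trans ?_)
    rw [mk_set, mk_complex, lift_continuum, lift_id']
    exact max_le (max_le continuum_le_two_power le_rfl)
      (aleph0_le_continuum.trans continuum_le_two_power)
  obtain ⟨f, hfc, hfs⟩ := exists_family_surjective mk_complex.le hι hP
    (fun P z => MvPolynomial.eval z P.1)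
    fun P => MvPolynomial.eval_surjective_of_constantCoeff_eq_zero P.2.1 P.2.2
  have happ : ∀ P x γ, MvPolynomial.aeval f P x γ = MvPolynomial.eval (fun j => f j x γ) P := by
    intro P x γ
    have h := MvPolynomial.comp_aeval_apply f ((Pi.evalAlgHom ℂ (fun _ : Γ => ℂ) γ).comp
      (Pi.evalAlgHom ℂ (fun _ : Λ → ℂ => Γ → ℂ) x)) P
    exact h.trans (by rw [MvPolynomial.aeval_eq_eval]; rfl)
  have hsurj : ∀ P : MvPolynomial (Set Γ) ℂ, P ≠ 0 → MvPolynomial.constantCoeff P = 0 →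
      Function.Surjective (MvPolynomial.aeval f P) := by
    intro P hP h0 y
    obtain ⟨x, hx⟩ := hfs ⟨P, hP, h0⟩ y
    exact ⟨x, funext fun γ => by rw [happ]; exact hx γ⟩
  have hli : LinearIndependent ℂ f := by
    refine linearIndependent_iff.2 fun c hc => ?_
    have hX := linearIndependent_iff.1 (MvPolynomial.linearIndependent_X (Set Γ) ℂ) c
    -- A nontrivial relation is a nonzero linear form, a polynomial without constant term, so its
    -- value at `f` would be both surjective and zero.
    refine hX (by_contra fun h => not_surjective_zero (X := Λ → ℂ) (Γ := Γ) (E := ℂ) ?_)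
    have h1 : MvPolynomial.aeval f (Finsupp.linearCombination ℂ (MvPolynomial.X (R := ℂ)) c) = 0 := by
      rw [← hc]
      simp [Finsupp.linearCombination_apply, Finsupp.sum]
    rw [← h1]
    refine hsurj _ h ?_
    simp [Finsupp.linearCombination_apply, Finsupp.sum]
  have hcardf := mk_range_set_eq.{u, v} hli.injective
  refine ⟨NonUnitalAlgebra.adjoin ℂ (Set.range f), fun F hF => ?_, ?_⟩
  · obtain ⟨P, hP0, rfl⟩ := NonUnitalAlgebra.exists_aeval_of_mem_adjoin_range hF
    by_cases hP : P = 0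
    · exact Or.inr (by simp [hP])
    · refine Or.inl ⟨continuous_uniform_of_factors ι _ fun x y hxy => ?_, hsurj P hP hP0⟩
      funext γ
      simp only [happ, fun j => hfc j x y hxy]
  · rw [← hcardf]
    refine isCardGenerated_adjoin_range hli ?_
    rw [hcardf, aleph0_lt_lift]
    exact aleph0_lt_continuum.trans_le continuum_le_two_power

theorem proposition5p1 {Λ : Type u} {Γ : Type v} [Infinite Λ] [Infinite Γ]
    (hcard : Cardinal.lift.{u} #Γ ≤ Cardinal.lift.{v} #Λ) :
    IsLineable ℝ (uniformCS Λ Γ ℝ) (Cardinal.lift.{u} (2 ^ #Γ)) ∧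
      IsAlgebrable ℂ (uniformCS Λ Γ ℂ) (Cardinal.lift.{u} (2 ^ #Γ)) :=
  ⟨isLineable_uniformCS hcard, isAlgebrable_uniformCS hcard⟩
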